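/- Let $A$ be a commutative ring and let $t,w\in A$ (for instance, two indeterminates with $A=\mathbb Z[t,w]$). Work in the ring $A[[q]]$ of formal power series, where infinite sums and products converge coefficientwise and $1/f$ is the inverse of a series $f$ with constant term $1$. Write $[n]_{x}=1+x+\cdots+x^{n-1}$. Let $M\ge 4$ be an even integer with $M\equiv 1$ or $4 \pmod 5$. Then $$ \begin{aligned} 1&+q\,\frac{t}{1-tq}+\frac{q^4}{1-tq}\cdot\frac{[M/2]_{q^2}+(w-1)q^{M-4}}{1-wq^M}\\ &+\sum_{k=3}^{M-1}\frac{q^{k^2}}{(1-tq)(1-q^3)(1-q^4)\cdots(1-q^k)}\cdot\frac{[M/2]_{q^2}}{1-wq^M}\\ &+\sum_{k=M}^{\infty}\frac{q^{k^2}}{(1-tq)(1-q^2)\cdots(1-q^{M-1})(1-wq^M)(1-q^{M+1})\cdots(1-q^k)}\\ &=\frac{1-q^M}{1-wq^M}\cdot\frac{1}{(1-tq)\prod_{k=0}^{\infty}(1-q^{5k+4})(1-q^{5k+6})}, \end{aligned} $$ where the infinite sum and the infinite product converge. (The exponents $5k+4,\,5k+6$, $k\ge 0$, are $4,6,9,11,14,16,\dots$,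 the integers greater than $1$ that are congruent to $1$ or $4$ modulo $5$.) -/

import Mathlib

open scoped PowerSeries.WithPiTopology

/-- The reciprocal `1 / f` of a formal power series.  It is only used for series with constant
coefficient `1`, which are units (see `fps_mul_recip`). -/
noncomputable def fpsRecip {A : Type*} [CommRing A] (f : PowerSeries A) : PowerSeries A :=
  Ring.inverse f

theorem fps_mul_recip {A : Type*} [CommRing A] (f : PowerSeries A)
    (hf : PowerSeries.constantCoeff f = 1) : f * fpsRecip f = 1 := by
  have h : IsUnit f := by
    rw [PowerSeries.isUnit_iff_constantCoeff, hf]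
    exact isUnit_one
  exact Ring.mul_inverse_cancel f h

/-- The bracket `[n]_x = 1 + x + ⋯ + x ^ (n - 1)`. -/
def qBracket {B : Type*} [CommRing B] (n : ℕ) (x : B) : B :=
  ∑ i ∈ Finset.range n, x ^ i

/-- `(1 - q ^ a) (1 - q ^ (a + 1)) ⋯ (1 - q ^ b)` in `A⟦q⟧` (empty product if `b < a`). -/
noncomputable def qProd (A : Type*) [CommRing A] (a b : ℕ) : PowerSeries A :=
  ∏ j ∈ Finset.Icc a b, (1 - PowerSeries.X ^ j)

/-- The term of the sum side with index `k ≥ M`: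
`q ^ (k ^ 2)` divided by
`(1 - t q) (1 - q ^ 2) ⋯ (1 - q ^ (M - 1)) (1 - w q ^ M) (1 - q ^ (M + 1)) ⋯ (1 - q ^ k)`. -/
noncomputable def tailTerm {A : Type*} [CommRing A] (t w : A) (M k : ℕ) : PowerSeries A :=
  PowerSeries.X ^ (k ^ 2) *
    fpsRecip ((1 - PowerSeries.C t * PowerSeries.X) * qProd A 2 (M - 1) *
      (1 - PowerSeries.C w * PowerSeries.X ^ M) * qProd A (M + 1) k)

/-- `(1 - q ^ (5 k + 4)) (1 - q ^ (5 k + 6))`; over `k = 0, 1, 2, …` the exponents run through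
`4, 6, 9, 11, 14, 16, …`, the integers greater than `1` that are `1` or `4` modulo `5`. -/
noncomputable def rrFactor (A : Type*) [CommRing A] (k : ℕ) : PowerSeries A :=
  (1 - PowerSeries.X ^ (5 * k + 4)) * (1 - PowerSeries.X ^ (5 * k + 6))

/-! After the missing factors are restored, each term of index `k ≥ 3` is
`(1-q)(1-q^M)/((1-tq)(1-wq^M))` times the Rogers–Ramanujan term `q^(k^2)/(q;q)_k`; the irregular
opening terms add up to the same multiple of the terms `k = 0, 1, 2`. The claim is therefore the
first Rogers–Ramanujan identity times a rational factor. That identity comes from Bailey's lemma,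
whose input is a Durfee-rectangle sum. The finite triple product at `z = 1` gives the unit Bailey
pair, and two Bailey steps give `finite_rogers_ramanujan`. Its limit is taken algebraically: modulo
`q^n` the base is nilpotent and all quantities stabilize. The triple product in base `p^5` then sums
the theta series. -/

/-! ### Bailey's lemma and finite identities. -/

section Bailey

variable {R : Type*} [CommRing R]

/-- The reciprocal `1 / (p; p)_n` of the `q`-factorial with base `p`. -/
noncomputable def qFactRecip (p : R) (n : ℕ) : R :=
  ∏ i ∈ Finset.range n, Ring.inverse (1 - p ^ (i + 1))

/-- The Bailey kernel `1 / ((p; p)_{N - j} (p; p)_{N + j})`, which is `0` for `j > N`. -/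
noncomputable def baileyKernel (p : R) (N j : ℕ) : R :=
  if j ≤ N then qFactRecip p (N - j) * qFactRecip p (N + j) else 0

/-- The weights `(-1) ^ j p ^ (j (j - 1) / 2) (z ^ j + y ^ j)` of a symmetrized theta series. -/
def thetaWeight (p z y : R) (j : ℕ) : R :=
  (-1) ^ j * p ^ (j.choose 2) * (z ^ j + y ^ j)

/-- The coefficient of index `j` of a theta series folded at `0`: `1` for `j = 0`, and
`thetaWeight` otherwise. -/
def thetaCoeff (p z y : R) (j : ℕ) : R :=
  if j = 0 then 1 else thetaWeight p z y j

theorem qFactRecip_zero (p : R) : qFactRecip p 0 = 1 := by simp [qFactRecip]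

theorem one_sub_pow_mul_qFactRecip {p : R} (hp : ∀ n, IsUnit (1 - p ^ (n + 1))) (n : ℕ) :
    (1 - p ^ (n + 1)) * qFactRecip p (n + 1) = qFactRecip p n := by
  rw [qFactRecip, Finset.prod_range_succ, mul_left_comm, Ring.mul_inverse_cancel _ (hp n), mul_one,
    qFactRecip]

theorem prod_mul_qFactRecip {p : R} (hp : ∀ n, IsUnit (1 - p ^ (n + 1))) (n : ℕ) :
    (∏ i ∈ Finset.range n, (1 - p ^ (i + 1))) * qFactRecip p n = 1 := by
  rw [qFactRecip, ← Finset.prod_mul_distrib]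
  exact Finset.prod_eq_one fun i _ => Ring.mul_inverse_cancel _ (hp i)

/-- A limiting case of the `q`-Vandermonde convolution (Durfee rectangles). -/
theorem sum_pow_mul_qFactRecip {p : R} (hp : ∀ n, IsUnit (1 - p ^ (n + 1))) (m c : ℕ) :
    ∑ s ∈ Finset.range (m + 1),
      p ^ (s * (s + c)) * (qFactRecip p s * qFactRecip p (m - s) * qFactRecip p (s + c)) =
    qFactRecip p m * qFactRecip p (m + c) := by
  induction m generalizing c with
  | zero => simp [qFactRecip_zero]
  | succ m ih =>
    have hu := one_sub_pow_mul_qFactRecip hp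
    set u := qFactRecip p
    apply (hp m).mul_left_cancel
    -- Uses `1 - p^(m+1) = (1 - p^(m+1-s)) + p^(m+1-s) (1 - p^s)`. Each part cancels one factor of a
    -- `q`-factorial, leaving the induction hypothesis at `c` and, after shifting `s`, at `c + 1`.
    have split : (1 - p ^ (m + 1)) * ∑ s ∈ Finset.range (m + 1 + 1),
          p ^ (s * (s + c)) * (u s * u (m + 1 - s) * u (s + c)) =
        (∑ s ∈ Finset.range (m + 1 + 1), p ^ (s * (s + c)) *
          (u s * ((1 - p ^ (m + 1 - s)) * u (m + 1 - s)) * u (s + c))) +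
        ∑ s ∈ Finset.range (m + 1 + 1), p ^ (s * (s + c)) * p ^ (m + 1 - s) *
          (((1 - p ^ s) * u s) * u (m + 1 - s) * u (s + c)) := by
      rw [Finset.mul_sum, ← Finset.sum_add_distrib]
      refine Finset.sum_congr rfl fun s hs => ?_
      obtain ⟨d, hd⟩ := Nat.exists_eq_add_of_le (Nat.lt_succ_iff.1 (Finset.mem_range.1 hs))
      rw [hd, Nat.add_sub_cancel_left]
      ring
    have first : ∑ s ∈ Finset.range (m + 1 + 1), p ^ (s * (s + c)) *
          (u s * ((1 - p ^ (m + 1 - s)) * u (m + 1 - s)) * u (s + c)) = u m * u (m + c) := by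
      rw [Finset.sum_range_succ, ← ih c]
      simp only [Nat.sub_self, pow_zero, sub_self, zero_mul, mul_zero, add_zero]
      refine Finset.sum_congr rfl fun s hs => ?_
      rw [Nat.succ_sub (Nat.lt_succ_iff.1 (Finset.mem_range.1 hs)), Nat.succ_eq_add_one, hu]
    have second : ∑ s ∈ Finset.range (m + 1 + 1), p ^ (s * (s + c)) * p ^ (m + 1 - s) *
          (((1 - p ^ s) * u s) * u (m + 1 - s) * u (s + c)) =
        p ^ (m + 1 + c) * (u m * u (m + (c + 1))) := by
      rw [Finset.sum_range_succ', ← ih (c + 1), Finset.mul_sum]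
      simp only [pow_zero, sub_self, zero_mul, mul_zero, add_zero]
      refine Finset.sum_congr rfl fun s hs => ?_
      obtain ⟨d, hd⟩ := Nat.exists_eq_add_of_le (Nat.lt_succ_iff.1 (Finset.mem_range.1 hs))
      rw [hu, Nat.add_sub_add_right, hd, Nat.add_sub_cancel_left,
        show s + 1 + c = s + (c + 1) by ring]
      ring
    rw [split, first, second, ← mul_assoc (1 - p ^ (m + 1)), hu,
      show m + 1 + c = m + c + 1 by ring, show m + (c + 1) = m + c + 1 by ring, ← hu (m + c)]
    ring

/-- With `r = j + s`, `r^2 = j^2 + s(s + 2j)`, so this is the Durfee-rectangle sum with `m = N - j`,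
`c = 2j`. -/
theorem sum_pow_mul_baileyKernel {p : R} (hp : ∀ n, IsUnit (1 - p ^ (n + 1))) (N j : ℕ) :
    ∑ r ∈ Finset.range (N + 1), p ^ (r ^ 2) * qFactRecip p (N - r) * baileyKernel p r j =
      p ^ (j ^ 2) * baileyKernel p N j := by
  by_cases hj : j ≤ N
  · obtain ⟨m, rfl⟩ := Nat.exists_eq_add_of_le hj
    rw [add_assoc, Finset.sum_range_add, Finset.sum_eq_zero, zero_add, baileyKernel, if_pos hj,
      Nat.add_sub_cancel_left, show j + m + j = m + 2 * j by ring,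
      ← sum_pow_mul_qFactRecip hp, Finset.mul_sum]
    · refine Finset.sum_congr rfl fun s _ => ?_
      rw [baileyKernel, if_pos (Nat.le_add_right j s), Nat.add_sub_add_left,
        Nat.add_sub_cancel_left, show j + s + j = s + 2 * j by ring]
      ring
    · intro r hr
      rw [baileyKernel, if_neg (not_le.2 (Finset.mem_range.1 hr)), mul_zero]
  · rw [baileyKernel, if_neg hj, mul_zero]
    refine Finset.sum_eq_zero fun r hr => ?_
    have := Finset.mem_range.1 hr
    rw [baileyKernel, if_neg (by omega), mul_zero]

/-- Bailey's lemma, with both parameters sent to infinity. -/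
theorem bailey_step {p : R} (hp : ∀ n, IsUnit (1 - p ^ (n + 1))) {α β : ℕ → R}
    (h : ∀ N, β N = ∑ j ∈ Finset.range (N + 1), α j * baileyKernel p N j) (N : ℕ) :
    ∑ r ∈ Finset.range (N + 1), p ^ (r ^ 2) * qFactRecip p (N - r) * β r =
      ∑ j ∈ Finset.range (N + 1), p ^ (j ^ 2) * α j * baileyKernel p N j := by
  have extend : ∀ r ∈ Finset.range (N + 1),
      β r = ∑ j ∈ Finset.range (N + 1), α j * baileyKernel p r j := by
    intro r hr
    rw [h r]
    refine Finset.sum_subset (Finset.range_mono (Finset.mem_range.1 hr)) fun j _ hj => ?_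
    rw [baileyKernel, if_neg (by simpa using hj), mul_zero]
  rw [Finset.sum_congr rfl fun r hr => by rw [extend r hr, Finset.mul_sum], Finset.sum_comm]
  refine Finset.sum_congr rfl fun j _ => ?_
  rw [mul_comm (p ^ (j ^ 2)), mul_assoc, ← sum_pow_mul_baileyKernel hp N j, Finset.mul_sum]
  exact Finset.sum_congr rfl fun r _ => by ring

/-- The three-term relation in `j` for the Bailey kernel. -/
theorem baileyKernel_succ {p : R} (hp : ∀ n, IsUnit (1 - p ^ (n + 1))) {N j : ℕ} (hj : j ≤ N) :
    (1 - p ^ (2 * N + 1)) * (1 - p ^ (2 * N + 2)) * baileyKernel p (N + 1) (j + 1) =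
      (1 + p ^ (2 * N + 1)) * baileyKernel p N (j + 1) + p ^ (N - j) * baileyKernel p N j +
        p ^ (N + j + 2) * baileyKernel p N (j + 2) := by
  have hu := one_sub_pow_mul_qFactRecip hp
  obtain ⟨m, rfl⟩ := Nat.exists_eq_add_of_le hj
  simp only [baileyKernel]
  -- The cases `N = j` and `N = j + 1` are separate because some kernels there are zero by
  -- convention.
  rcases m with _ | _ | m
  · have h1 := hu (2 * j)
    have h2 := hu (2 * j + 1)
    simp only [add_zero, Nat.sub_self, le_refl, if_true, pow_zero,
      show ¬ (j + 1 ≤ j) by omega, show ¬ (j + 2 ≤ j) by omega, if_false,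
      show j + 1 + (j + 1) = 2 * j + 1 + 1 by ring, ← two_mul j, mul_zero]
    rw [← h1, ← h2]
    ring
  · have h0 := hu 0
    have h1 := hu (2 * j + 1)
    have h2 := hu (2 * j + 2)
    simp only [show j + 1 ≤ j + (0 + 1) by omega, show j + 1 ≤ j + (0 + 1) + 1 by omega,
      show j ≤ j + (0 + 1) by omega, show ¬ (j + 2 ≤ j + (0 + 1)) by omega, if_true, if_false,
      show j + (0 + 1) - (j + 1) = 0 by omega, show j + (0 + 1) + 1 - (j + 1) = 0 + 1 by omega,
      show j + (0 + 1) - j = 0 + 1 by omega, show j + (0 + 1) + (j + 1) = 2 * j + 1 + 1 by ring,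
      show j + (0 + 1) + 1 + (j + 1) = 2 * j + 2 + 1 by ring,
      show j + (0 + 1) + j = 2 * j + 1 by ring, mul_zero, add_zero]
    rw [← h1, ← h2, ← h0]
    ring
  · have h0 := hu m
    have h1 := hu (m + 1)
    have h2 := hu (2 * j + m + 2)
    have h3 := hu (2 * j + m + 3)
    simp only [show j + 1 ≤ j + (m + 1 + 1) by omega, show j + 1 ≤ j + (m + 1 + 1) + 1 by omega,
      show j ≤ j + (m + 1 + 1) by omega, show j + 2 ≤ j + (m + 1 + 1) by omega, if_true,
      show j + (m + 1 + 1) - (j + 1) = m + 1 by omega,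
      show j + (m + 1 + 1) + 1 - (j + 1) = m + 1 + 1 by omega,
      show j + (m + 1 + 1) - j = m + 1 + 1 by omega,
      show j + (m + 1 + 1) - (j + 2) = m by omega,
      show j + (m + 1 + 1) + (j + 1) = 2 * j + m + 2 + 1 by ring,
      show j + (m + 1 + 1) + 1 + (j + 1) = 2 * j + m + 3 + 1 by ring,
      show j + (m + 1 + 1) + j = 2 * j + m + 2 by ring,
      show j + (m + 1 + 1) + (j + 2) = 2 * j + m + 3 + 1 by ring]
    rw [← h0, ← h1, ← h2, ← h3]
    ring

/-- The case `j = -1` of the previous relation, the kernel being even in `j`. -/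
theorem baileyKernel_zero {p : R} (hp : ∀ n, IsUnit (1 - p ^ (n + 1))) (N : ℕ) :
    (1 - p ^ (2 * N + 1)) * (1 - p ^ (2 * N + 2)) * baileyKernel p (N + 1) 0 =
      (1 + p ^ (2 * N + 1)) * baileyKernel p N 0 + 2 * p ^ (N + 1) * baileyKernel p N 1 := by
  have hu := one_sub_pow_mul_qFactRecip hp
  have h0 := hu N
  rcases N with _ | N
  · simp only [baileyKernel]
    norm_num
    rw [← h0]
    ring
  · have h1 := hu N
    have h2 := hu (N + 1)
    simp only [baileyKernel, Nat.zero_le, if_true, Nat.sub_zero, add_zero,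
      Nat.add_sub_cancel, show 1 ≤ N + 1 by omega]
    rw [← h1, ← h2]
    ring

/-- Follows from `(z+y)(z^(j+1)+y^(j+1)) = z^(j+2)+y^(j+2) + zy(z^j+y^j)`. It moves the cross term
of `(1 - z p^N)(1 - y p^N)` onto the neighbouring weights, which makes the next sum telescope. -/
theorem thetaWeight_succ {p z y : R} (hzy : z * y = p) {N j : ℕ} (hj : j + 1 ≤ N) :
    -((z + y) * p ^ N * thetaWeight p z y (j + 1)) =
      p ^ (N - (j + 1)) * thetaWeight p z y (j + 2) + p ^ (N + j + 1) * thetaWeight p z y j := by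
  obtain ⟨m, rfl⟩ := Nat.exists_eq_add_of_le hj
  have h1 : (j + 1).choose 2 = j + j.choose 2 := by
    rw [Nat.choose_succ_succ' j 1, Nat.choose_one_right]
  have h2 : (j + 2).choose 2 = j + 1 + (j + j.choose 2) := by
    rw [Nat.choose_succ_succ' (j + 1) 1, Nat.choose_one_right, h1]
  simp only [thetaWeight, h1, h2, Nat.add_sub_cancel_left]
  linear_combination ((-1) ^ j * p ^ (2 * j + 1 + m + j.choose 2) * (z ^ j + y ^ j)) * hzy

/-- At `K = N + 1` both boundary kernels vanish, which gives the recurrence in `N` behind the finite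
triple product. -/
theorem sum_thetaCoeff_telescope {p z y : R} (hp : ∀ n, IsUnit (1 - p ^ (n + 1)))
    (hzy : z * y = p) (N K : ℕ) (hK : K ≤ N + 1) :
    ∑ j ∈ Finset.range (K + 1), thetaCoeff p z y j *
      ((1 - p ^ (2 * N + 1)) * (1 - p ^ (2 * N + 2)) * baileyKernel p (N + 1) j -
        (1 - z * p ^ N) * (1 - y * p ^ N) * baileyKernel p N j) =
    thetaWeight p z y K * p ^ (N + K + 1) * baileyKernel p N (K + 1) -
      thetaWeight p z y (K + 1) * p ^ (N - K) * baileyKernel p N K := by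
  induction K with
  | zero =>
    rw [Finset.sum_range_one, baileyKernel_zero hp]
    simp only [thetaCoeff, thetaWeight, if_true]
    norm_num
    linear_combination (-p ^ (2 * N) * baileyKernel p N 0) * hzy
  | succ K ih =>
    have hKN : K ≤ N := by omega
    rw [Finset.sum_range_succ, ih (by omega), baileyKernel_succ hp hKN,
      thetaCoeff, if_neg (Nat.succ_ne_zero K)]
    rcases hKN.eq_or_lt with rfl | hlt
    · simp only [baileyKernel, show ¬ (K + 1 ≤ K) by omega, show ¬ (K + 1 + 1 ≤ K) by omega, if_false]
      ring
    · have h := thetaWeight_succ hzy (show K + 1 ≤ N from hlt)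
      linear_combination (-baileyKernel p N (K + 1)) * h +
        (-thetaWeight p z y (K + 1) * p ^ (2 * N) * baileyKernel p N (K + 1)) * hzy

/-- A finite form of the Jacobi triple product identity. -/
theorem finite_jacobi_triple_product {p z y : R} (hp : ∀ n, IsUnit (1 - p ^ (n + 1)))
    (hzy : z * y = p) (N : ℕ) :
    (∏ i ∈ Finset.range (2 * N), (1 - p ^ (i + 1))) *
      ∑ j ∈ Finset.range (N + 1), thetaCoeff p z y j * baileyKernel p N j =
    ∏ i ∈ Finset.range N, ((1 - z * p ^ i) * (1 - y * p ^ i)) := by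
  induction N with
  | zero => simp [thetaCoeff, baileyKernel, qFactRecip_zero]
  | succ N ih =>
    have h := sum_thetaCoeff_telescope hp hzy N (N + 1) le_rfl
    have h0 : ∀ j, N < j → baileyKernel p N j = 0 := fun j hj => if_neg (not_le.2 hj)
    rw [h0 (N + 1) (by omega), h0 (N + 1 + 1) (by omega), mul_zero, mul_zero, sub_zero,
      Finset.sum_congr rfl fun j _ => mul_sub _ _ _, Finset.sum_sub_distrib,
      Finset.sum_range_succ (fun j => thetaCoeff p z y j * (_ * baileyKernel p N j)),
      h0 (N + 1) (by omega), mul_zero, mul_zero, add_zero, sub_eq_zero,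
      Finset.sum_congr rfl fun j _ => mul_left_comm _ _ _, ← Finset.mul_sum,
      Finset.sum_congr rfl fun j _ => mul_left_comm _ _ _, ← Finset.mul_sum] at h
    rw [show 2 * (N + 1) = 2 * N + 1 + 1 by ring, Finset.prod_range_succ, Finset.prod_range_succ,
      Finset.prod_range_succ, ← ih]
    linear_combination (∏ i ∈ Finset.range (2 * N), (1 - p ^ (i + 1))) * h

/-- A finite form of the first Rogers–Ramanujan identity, before the theta series on the right
is summed. -/
theorem finite_rogers_ramanujan {p : R} (hp : ∀ n, IsUnit (1 - p ^ (n + 1))) (N : ℕ) :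
    ∑ r ∈ Finset.range (N + 1), p ^ (r ^ 2) * qFactRecip p (N - r) * qFactRecip p r =
      ∑ j ∈ Finset.range (N + 1),
        thetaCoeff (p ^ 5) (p ^ 2) (p ^ 3) j * baileyKernel p N j := by
  -- Unit Bailey pair: at `z = 1` the factor `1 - z p^0` kills the product for `N > 0`.
  have base : ∀ N, (if N = 0 then (1 : R) else 0) =
      ∑ j ∈ Finset.range (N + 1), thetaCoeff p 1 p j * baileyKernel p N j := by
    intro N
    have h := finite_jacobi_triple_product hp (one_mul p) N
    rcases N with _ | N
    · simp [thetaCoeff, baileyKernel, qFactRecip_zero]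
    · rw [Finset.prod_range_succ' _ N, pow_zero, mul_one, sub_self, zero_mul, mul_zero] at h
      rw [if_neg (Nat.succ_ne_zero N)]
      have hu : IsUnit (∏ i ∈ Finset.range (2 * (N + 1)), (1 - p ^ (i + 1))) :=
        IsUnit.of_mul_eq_one _ (prod_mul_qFactRecip hp _)
      exact (hu.mul_left_cancel (h.trans (mul_zero _).symm)).symm
  have step : ∀ N, qFactRecip p N =
      ∑ j ∈ Finset.range (N + 1), p ^ (j ^ 2) * thetaCoeff p 1 p j * baileyKernel p N j := by
    intro N
    rw [← bailey_step hp base N, Finset.sum_eq_single 0]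
    · simp
    · intro r _ hr
      rw [if_neg hr, mul_zero]
    · simp
  rw [bailey_step hp step N]
  refine Finset.sum_congr rfl fun j _ => ?_
  congr 1
  unfold thetaCoeff
  split_ifs with hj
  · simp [hj]
  -- Turns the factor `p^(2j^2)` left by two Bailey steps into the change of base from `p` to `p^5`.
  · have hc : j + 2 * j.choose 2 = j ^ 2 := by
      rw [Nat.choose_two_right, Nat.mul_div_cancel' (Nat.even_mul_pred_self j).two_dvd]
      rcases j with _ | j
      · rfl
      · simp only [Nat.add_sub_cancel]; ring
    simp only [thetaWeight, ← hc]
    ring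

end Bailey

/-! ### Rogers–Ramanujan for a nilpotent base. -/

section Nilpotent

variable {R : Type*} [CommRing R]

theorem isUnit_one_sub_pow_succ_of_pow_eq_zero {p : R} {n : ℕ} (h : p ^ n = 0) (k : ℕ) :
    IsUnit (1 - p ^ (k + 1)) :=
  IsNilpotent.isUnit_one_sub (IsNilpotent.pow_succ k ⟨n, h⟩)

theorem prod_range_eq_of_eq_one {f : ℕ → R} {n m : ℕ} (hf : ∀ i, n ≤ i → f i = 1) (hm : n ≤ m) :
    ∏ i ∈ Finset.range m, f i = ∏ i ∈ Finset.range n, f i := by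
  refine (Finset.prod_subset (Finset.range_mono hm) fun i _ hi => hf i ?_).symm
  simpa using hi

theorem sum_range_eq_of_eq_zero {f : ℕ → R} {n m : ℕ} (hf : ∀ i, n ≤ i → f i = 0) (hm : n ≤ m) :
    ∑ i ∈ Finset.range m, f i = ∑ i ∈ Finset.range n, f i := by
  refine (Finset.sum_subset (Finset.range_mono hm) fun i _ hi => hf i ?_).symm
  simpa using hi

theorem qFactRecip_eq_of_pow_eq_zero {p : R} {n m : ℕ} (h : p ^ n = 0) (hm : n ≤ m) :
    qFactRecip p m = qFactRecip p n :=
  prod_range_eq_of_eq_one (fun i hi => by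
    rw [pow_eq_zero_of_le (by omega : n ≤ i + 1) h, sub_zero, Ring.inverse_one]) hm

theorem prod_range_five_mul {S : Type*} [CommMonoid S] (f : ℕ → S) (n : ℕ) :
    ∏ i ∈ Finset.range (5 * n), f (i + 1) =
      (∏ i ∈ Finset.range n, (f (5 * i + 1) * f (5 * i + 4))) *
      (∏ i ∈ Finset.range n, (f (5 * i + 2) * f (5 * i + 3))) *
      ∏ i ∈ Finset.range n, f (5 * (i + 1)) := by
  rw [← Finset.prod_mul_distrib, ← Finset.prod_mul_distrib]
  induction n with
  | zero => simp
  | succ n ih =>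
    rw [show 5 * (n + 1) = 5 * n + 1 + 1 + 1 + 1 + 1 by ring]
    simp only [Finset.prod_range_succ, ih]
    simp only [mul_add, mul_one, add_assoc, mul_assoc, Nat.reduceAdd]
    congr 2
    simp only [mul_left_comm, mul_comm]

/-- Taking `N = 2n` puts both `N - j` and `N + j` at or above `n` when `j < n`, so the kernel has
reached its limit `c^2`. -/
theorem sum_thetaCoeff_mul_baileyKernel {p c : R} {f : ℕ → R} {n : ℕ} (h : p ^ n = 0)
    (hc : ∀ j, n ≤ j → f j = 0) (hu : qFactRecip p n = c) :
    ∑ j ∈ Finset.range (2 * n + 1), f j * baileyKernel p (2 * n) j =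
      c ^ 2 * ∑ j ∈ Finset.range n, f j := by
  rw [sum_range_eq_of_eq_zero (n := n) (fun j hj => by rw [hc j hj, zero_mul]) (by omega),
    Finset.mul_sum]
  refine Finset.sum_congr rfl fun j hj => ?_
  have hj := Finset.mem_range.1 hj
  rw [baileyKernel, if_pos (by omega),
    qFactRecip_eq_of_pow_eq_zero h (show n ≤ 2 * n - j by omega),
    qFactRecip_eq_of_pow_eq_zero h (show n ≤ 2 * n + j by omega), hu]
  ring

/-- The first Rogers–Ramanujan identity for a nilpotent base. -/
theorem rogers_ramanujan_of_pow_eq_zero {p : R} {n : ℕ} (h : p ^ n = 0) :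
    (∏ i ∈ Finset.range n, ((1 - p ^ (5 * i + 1)) * (1 - p ^ (5 * i + 4)))) *
      ∑ r ∈ Finset.range n, p ^ (r ^ 2) * qFactRecip p r = 1 := by
  rcases Nat.eq_zero_or_pos n with rfl | hn
  · have := subsingleton_of_zero_eq_one (h.symm.trans (pow_zero p))
    exact Subsingleton.elim _ _
  have hp := isUnit_one_sub_pow_succ_of_pow_eq_zero h
  have h5 : (p ^ 5) ^ n = 0 := by rw [pow_right_comm, h, zero_pow (by norm_num)]
  have hp5 := isUnit_one_sub_pow_succ_of_pow_eq_zero h5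
  have hpow : ∀ k, n ≤ k → p ^ k = 0 := fun k hk => pow_eq_zero_of_le hk h
  have hweight : ∀ j, n ≤ j → thetaCoeff (p ^ 5) (p ^ 2) (p ^ 3) j = 0 := fun j hj => by
    rw [thetaCoeff, if_neg (by omega), thetaWeight, ← pow_mul, ← pow_mul, ← pow_mul,
      hpow (2 * j) (by omega), hpow (3 * j) (by omega), add_zero, mul_zero]
  have hfin := finite_rogers_ramanujan hp (2 * n)
  rw [sum_thetaCoeff_mul_baileyKernel h hweight rfl, sum_range_eq_of_eq_zero (n := n)
    (fun j hj => by rw [hpow (j ^ 2) (hj.trans (Nat.le_self_pow two_ne_zero j)), zero_mul,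
      zero_mul]) (by omega),
    Finset.sum_congr rfl fun r hr => by
      rw [qFactRecip_eq_of_pow_eq_zero h
        (show n ≤ 2 * n - r by have := Finset.mem_range.1 hr; omega),
        mul_right_comm], ← Finset.sum_mul] at hfin
  have hjac := finite_jacobi_triple_product hp5 (show p ^ 2 * p ^ 3 = p ^ 5 by ring) (2 * n)
  rw [sum_thetaCoeff_mul_baileyKernel h5 hweight rfl,
    prod_range_eq_of_eq_one (n := n) (fun i hi => by
      rw [pow_eq_zero_of_le (by omega : n ≤ i + 1) h5, sub_zero]) (by omega),
    prod_range_eq_of_eq_one (n := n) (m := 2 * n) (fun i hi => by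
      rw [pow_eq_zero_of_le hi h5, mul_zero, mul_zero, sub_zero, mul_one]) (by omega)] at hjac
  have hQ : ∏ i ∈ Finset.range n, ((1 - p ^ 2 * (p ^ 5) ^ i) * (1 - p ^ 3 * (p ^ 5) ^ i)) =
      ∏ i ∈ Finset.range n, ((1 - p ^ (5 * i + 2)) * (1 - p ^ (5 * i + 3))) :=
    Finset.prod_congr rfl fun i _ => by ring
  have hQ5 : ∏ i ∈ Finset.range n, (1 - (p ^ 5) ^ (i + 1)) =
      ∏ i ∈ Finset.range n, (1 - p ^ (5 * (i + 1))) :=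
    Finset.prod_congr rfl fun i _ => by rw [pow_mul]
  have hinv5 := prod_mul_qFactRecip hp5 n
  have hinv := prod_mul_qFactRecip hp n
  have hprod := prod_range_five_mul (fun k => 1 - p ^ k) n
  rw [prod_range_eq_of_eq_one (n := n) (fun i hi => by
    rw [pow_eq_zero_of_le (by omega : n ≤ i + 1) h, sub_zero]) (by omega)] at hprod
  rw [hQ, hQ5] at hjac
  rw [hQ5] at hinv5
  set P := ∏ i ∈ Finset.range n, (1 - p ^ (i + 1))
  set Q5 := ∏ i ∈ Finset.range n, (1 - p ^ (5 * (i + 1)))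
  set Q14 := ∏ i ∈ Finset.range n, ((1 - p ^ (5 * i + 1)) * (1 - p ^ (5 * i + 4)))
  set Q23 := ∏ i ∈ Finset.range n, ((1 - p ^ (5 * i + 2)) * (1 - p ^ (5 * i + 3)))
  set S := ∑ r ∈ Finset.range n, p ^ (r ^ 2) * qFactRecip p r
  set Θ := ∑ j ∈ Finset.range n, thetaCoeff (p ^ 5) (p ^ 2) (p ^ 3) j
  -- The triple product sums the theta series; as `P = Q14 * Q23 * Q5`, dividing by `P` leaves `1 /
  -- Q14`.
  have hΘ : Θ = Q5 * Q23 := by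
    linear_combination Q5 * hjac - (Θ * (Q5 * qFactRecip (p ^ 5) n + 1)) * hinv5
  have hS : S = qFactRecip p n * Θ := by
    linear_combination P * hfin - (S - qFactRecip p n * Θ) * hinv
  rw [hS, hΘ]
  linear_combination hinv - qFactRecip p n * hprod

end Nilpotent

/-! ### Passage to power series. -/

section PowerSeries

variable {A : Type*} [CommRing A]

open PowerSeries

theorem isUnit_one_sub_X_pow_succ (n : ℕ) : IsUnit (1 - (X : A⟦X⟧) ^ (n + 1)) := by
  rw [isUnit_iff_constantCoeff]
  simp

theorem map_qFactRecip {R S : Type*} [CommRing R] [CommRing S] (φ : R →+* S) {p : R}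
    (hp : ∀ n, IsUnit (1 - p ^ (n + 1))) (n : ℕ) :
    φ (qFactRecip p n) = qFactRecip (φ p) n := by
  have hp' : ∀ n, IsUnit (1 - φ p ^ (n + 1)) := fun n => by simpa using (hp n).map φ
  have h := congrArg φ (prod_mul_qFactRecip hp n)
  rw [map_mul, map_prod, map_one] at h
  simp only [map_sub, map_one, map_pow] at h
  have h' := prod_mul_qFactRecip hp' n
  exact (IsUnit.of_mul_eq_one _ h').mul_left_cancel (h.trans h'.symm)

/-- The first Rogers–Ramanujan identity modulo `X ^ n`. -/
theorem X_pow_dvd_rogers_ramanujan (n : ℕ) :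
    (X : A⟦X⟧) ^ n ∣ (1 - X) * (∏ i ∈ Finset.range n, rrFactor A i) *
      (∑ r ∈ Finset.range n, X ^ (r ^ 2) * qFactRecip X r) - 1 := by
  rw [← Ideal.mem_span_singleton, ← Ideal.Quotient.eq_zero_iff_mem, map_sub, map_one, sub_eq_zero]
  set φ := Ideal.Quotient.mk (Ideal.span {(X : A⟦X⟧) ^ n})
  have hX : φ X ^ n = 0 := by
    rw [← map_pow, Ideal.Quotient.eq_zero_iff_mem]
    exact Ideal.mem_span_singleton_self _
  -- Reindexes the exponents `5i+1, 5i+4` as `1` followed by `5i+4, 5i+6`; the surplus last factor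
  -- becomes `1` modulo `X^n`.
  have shift : ∀ p : A⟦X⟧ ⧸ Ideal.span {(X : A⟦X⟧) ^ n}, ∀ m,
      (∏ i ∈ Finset.range m, ((1 - p ^ (5 * i + 1)) * (1 - p ^ (5 * i + 4)))) *
        (1 - p ^ (5 * m + 1)) =
      (1 - p) * ∏ i ∈ Finset.range m, ((1 - p ^ (5 * i + 4)) * (1 - p ^ (5 * i + 6))) := by
    intro p m
    induction m with
    | zero => simp
    | succ m ih =>
      rw [Finset.prod_range_succ, Finset.prod_range_succ, ← mul_assoc (1 - p), ← ih]
      ring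
  have h := rogers_ramanujan_of_pow_eq_zero hX
  have hs := shift (φ X) n
  rw [pow_eq_zero_of_le (by omega : n ≤ 5 * n + 1) hX, sub_zero, mul_one] at hs
  rw [hs] at h
  simpa [rrFactor, map_qFactRecip φ isUnit_one_sub_X_pow_succ] using h

theorem summable_X_pow_sq_mul [TopologicalSpace A] (f : ℕ → A⟦X⟧) : Summable fun r : ℕ => X ^ (r ^ 2) * f r := by
  nontriviality A
  apply WithPiTopology.summable_of_tendsto_order_atTop_nhds_top
  refine ENat.tendsto_nhds_top_iff_natCast_lt.mpr fun n =>
    Filter.eventually_atTop.mpr ⟨n + 1, fun m hm => ?_⟩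
  refine lt_of_lt_of_le ?_ (le_order_mul _ _)
  refine lt_of_lt_of_le ?_ le_self_add
  rw [order_X_pow]
  exact_mod_cast lt_of_lt_of_le hm (Nat.le_self_pow two_ne_zero m)

variable [TopologicalSpace A] [DiscreteTopology A]

theorem multipliable_rrFactor : Multipliable fun k : ℕ => rrFactor A k := by
  nontriviality A
  have h : ∀ a, Multipliable fun k : ℕ => 1 - (X : A⟦X⟧) ^ (5 * k + (a + 1)) := fun a => by
    simp_rw [sub_eq_add_neg]
    apply WithPiTopology.multipliable_one_add_of_tendsto_order_atTop_nhds_top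
    refine ENat.tendsto_nhds_top_iff_natCast_lt.mpr fun n =>
      Filter.eventually_atTop.mpr ⟨n, fun m hm => ?_⟩
    rw [order_neg, order_X_pow]
    norm_cast
    omega
  exact (h 3).mul (h 5)

/-- The first Rogers–Ramanujan identity. -/
theorem rogers_ramanujan :
    (1 - X) * (∏' k, rrFactor A k) * ∑' r : ℕ, X ^ (r ^ 2) * qFactRecip (X : A⟦X⟧) r = 1 := by
  have hlim := (tendsto_const_nhds (x := 1 - (X : A⟦X⟧))).mul
    ((multipliable_rrFactor (A := A)).hasProd.tendsto_prod_nat) |>.mul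
    (summable_X_pow_sq_mul (qFactRecip (X : A⟦X⟧))).hasSum.tendsto_sum_nat
  refine tendsto_nhds_unique hlim ?_
  rw [WithPiTopology.tendsto_iff_coeff_tendsto]
  refine fun d => tendsto_const_nhds.congr' ?_
  filter_upwards [Filter.eventually_gt_atTop d] with n hn
  have h := X_pow_dvd_iff.1 (X_pow_dvd_rogers_ramanujan (A := A) n) d hn
  rw [map_sub, sub_eq_zero] at h
  exact h.symm

end PowerSeries

/-! ### Reduction of the theorem to Rogers–Ramanujan. -/

section Main

variable {A : Type*} [CommRing A]

open PowerSeries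

theorem fpsRecip_mul (f g : A⟦X⟧) : fpsRecip (f * g) = fpsRecip f * fpsRecip g := by
  rw [fpsRecip, Ring.mul_inverse_rev, mul_comm, fpsRecip, fpsRecip]

theorem fpsRecip_eq_of_mul_eq_one {f g : A⟦X⟧} (h : f * g = 1) : fpsRecip f = g :=
  (IsUnit.of_mul_eq_one _ h).mul_left_cancel
    ((Ring.mul_inverse_cancel f (IsUnit.of_mul_eq_one _ h)).trans h.symm)

theorem one_sub_mul_X_pow_mul_fpsRecip (a : A) {n : ℕ} (hn : n ≠ 0) :
    (1 - C a * X ^ n) * fpsRecip (1 - C a * X ^ n) = 1 :=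
  fps_mul_recip _ (by simp [hn])

theorem qProd_one_mul_qFactRecip (k : ℕ) : qProd A 1 k * qFactRecip X k = 1 := by
  rw [← prod_mul_qFactRecip isUnit_one_sub_X_pow_succ k, qProd,
    Finset.range_eq_Ico, Finset.prod_Ico_add' (fun j => 1 - (X : A⟦X⟧) ^ j) 0 k 1, zero_add,
    ← Finset.Ico_succ_right_eq_Icc, Nat.succ_eq_succ]

theorem one_sub_mul_qBracket {B : Type*} [CommRing B] (n : ℕ) (x : B) :
    (1 - x) * qBracket n x = 1 - x ^ n :=
  mul_neg_geom_sum x n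

theorem qProd_mul_qProd {a b c : ℕ} (hab : a ≤ b + 1) (hbc : b ≤ c) :
    qProd A a b * qProd A (b + 1) c = qProd A a c := by
  unfold qProd
  rw [← Finset.Ico_succ_right_eq_Icc, ← Finset.Ico_succ_right_eq_Icc,
    ← Finset.Ico_succ_right_eq_Icc]
  exact Finset.prod_Ico_consecutive _ hab (by simpa using hbc)

theorem qProd_self (a : ℕ) : qProd A a a = 1 - X ^ a := by simp [qProd]

/-- The denominator lacks only `1 - q` and `1 - q^M` from the full `q`-factorial; restoring them
exposes the common multiple. -/
theorem tailTerm_eq (t w : A) {M : ℕ} (hM : 2 ≤ M) (i : ℕ) :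
    tailTerm t w M (M + i) =
      (1 - X) * (1 - X ^ M) * fpsRecip (1 - C t * X) * fpsRecip (1 - C w * X ^ M) *
        (X ^ ((M + i) ^ 2) * qFactRecip X (M + i)) := by
  have h := qProd_one_mul_qFactRecip (A := A) (M + i)
  have h1 : qProd A 1 (M + i) =
      (1 - X) * qProd A 2 (M - 1) * (1 - X ^ M) * qProd A (M + 1) (M + i) := by
    obtain ⟨m, rfl⟩ := Nat.exists_eq_add_of_le' (show 1 ≤ M by omega)
    rw [← qProd_mul_qProd (show 1 ≤ m + 1 + 1 by omega) (show m + 1 ≤ m + 1 + i by omega),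
      ← qProd_mul_qProd (show 1 ≤ m + 1 by omega) (show m ≤ m + 1 by omega), qProd_self,
      ← qProd_mul_qProd (show 1 ≤ 1 + 1 by omega) (show 1 ≤ m by omega), qProd_self, pow_one,
      Nat.add_sub_cancel]
  rw [h1] at h
  have h2 : fpsRecip (qProd A 2 (M - 1) * qProd A (M + 1) (M + i)) =
      (1 - X) * (1 - X ^ M) * qFactRecip X (M + i) :=
    fpsRecip_eq_of_mul_eq_one (by linear_combination h)
  rw [fpsRecip_mul] at h2
  rw [tailTerm, fpsRecip_mul, fpsRecip_mul, fpsRecip_mul]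
  linear_combination (X ^ ((M + i) ^ 2) * fpsRecip (1 - C t * X) *
    fpsRecip (1 - C w * X ^ M)) * h2

theorem fpsRecip_qProd_three {k : ℕ} (hk : 3 ≤ k) :
    fpsRecip (qProd A 3 k) = (1 - X) * (1 - X ^ 2) * qFactRecip X k := by
  refine fpsRecip_eq_of_mul_eq_one ?_
  have h := qProd_one_mul_qFactRecip (A := A) k
  rw [← qProd_mul_qProd (show 1 ≤ 2 + 1 by omega) (show 2 ≤ k by omega),
    ← qProd_mul_qProd (show 1 ≤ 1 + 1 by omega) (show 1 ≤ 2 by omega), qProd_self, qProd_self,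
    pow_one] at h
  linear_combination h

end Main

theorem mainTheorem8 {A : Type*} [CommRing A] [TopologicalSpace A] [DiscreteTopology A]
    (t w : A) (M : ℕ) (hM : 4 ≤ M) (hEven : Even M) (hmod : M % 5 = 1 ∨ M % 5 = 4) :
    let q : PowerSeries A := PowerSeries.X
    let T : PowerSeries A := PowerSeries.C t
    let W : PowerSeries A := PowerSeries.C w
    Summable (fun i : ℕ => tailTerm t w M (M + i)) ∧
    Multipliable (fun k : ℕ => rrFactor A k) ∧
    1 + q * (T * fpsRecip (1 - T * q))
      + q ^ 4 * fpsRecip (1 - T * q) *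
        ((qBracket (M / 2) (q ^ 2) + (W - 1) * q ^ (M - 4)) * fpsRecip (1 - W * q ^ M))
      + ∑ k ∈ Finset.Icc 3 (M - 1),
          q ^ (k ^ 2) * fpsRecip ((1 - T * q) * qProd A 3 k) *
            (qBracket (M / 2) (q ^ 2) * fpsRecip (1 - W * q ^ M))
      + ∑' i : ℕ, tailTerm t w M (M + i)
    = (1 - q ^ M) * fpsRecip (1 - W * q ^ M) *
        fpsRecip ((1 - T * q) * ∏' k : ℕ, rrFactor A k) := by
  intro q T W
  set a := fpsRecip (1 - T * q) with ha
  set b := fpsRecip (1 - W * q ^ M) with hb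
  set g : ℕ → PowerSeries A := fun r => q ^ (r ^ 2) * qFactRecip q r with hg
  have hsum : Summable g := summable_X_pow_sq_mul _
  have hshift : Summable fun i => g (M + i) := by
    simpa only [add_comm M] using (summable_nat_add_iff M).2 hsum
  have htail : (fun i => tailTerm t w M (M + i)) =
      fun i => (1 - q) * (1 - q ^ M) * a * b * g (M + i) :=
    funext fun i => tailTerm_eq t w (by omega) i
  have ha1 : (1 - T * q) * a = 1 := by
    simpa only [pow_one] using one_sub_mul_X_pow_mul_fpsRecip t one_ne_zero
  have hb1 : (1 - W * q ^ M) * b = 1 := one_sub_mul_X_pow_mul_fpsRecip w (by omega)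
  -- Evenness of `M` enters here: the bracket trades the missing `1 - q^2` for `1 - q^M`.
  have hbr : (1 - q ^ 2) * qBracket (M / 2) (q ^ 2) = 1 - q ^ M := by
    rw [one_sub_mul_qBracket, ← pow_mul, Nat.mul_div_cancel' hEven.two_dvd]
  refine ⟨htail ▸ hshift.mul_left _, multipliable_rrFactor, ?_⟩
  have hrr := rogers_ramanujan (A := A)
  have hprod : fpsRecip (∏' k, rrFactor A k) = (1 - q) * ∑' r, g r :=
    fpsRecip_eq_of_mul_eq_one ((mul_left_comm _ _ _).trans ((mul_assoc _ _ _).symm.trans hrr))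
  have hmid : ∀ k ∈ Finset.Icc 3 (M - 1),
      q ^ (k ^ 2) * fpsRecip ((1 - T * q) * qProd A 3 k) * (qBracket (M / 2) (q ^ 2) * b) =
        (1 - q) * (1 - q ^ M) * a * b * g k := fun k hk => by
    rw [fpsRecip_mul, fpsRecip_qProd_three (Finset.mem_Icc.1 hk).1, ← ha, hg]
    linear_combination (q ^ (k ^ 2) * a * b * (1 - q) * qFactRecip q k) * hbr
  have hsplit : ∑' r, g r =
      g 0 + g 1 + g 2 + ∑ k ∈ Finset.Icc 3 (M - 1), g k + ∑' i, g (M + i) := by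
    rw [← hsum.sum_add_tsum_nat_add M]
    simp only [add_comm _ M]
    rw [Finset.range_eq_Ico, ← Finset.sum_Ico_consecutive g (show 0 ≤ 3 by omega)
      (show 3 ≤ M by omega), ← Finset.range_eq_Ico]
    simp only [Finset.sum_range_succ, Finset.sum_range_zero, zero_add]
    rw [← Finset.Ico_succ_right_eq_Icc, Nat.succ_eq_succ, Nat.succ_eq_add_one,
      Nat.sub_add_cancel (by omega)]
  have hu := one_sub_pow_mul_qFactRecip (isUnit_one_sub_X_pow_succ (A := A))
  have hg0 : g 0 = 1 := by simp [hg, qFactRecip_zero]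
  have hg1 : (1 - q) * g 1 = q := by
    have := hu 0
    rw [qFactRecip_zero, zero_add, pow_one] at this
    simp only [hg, one_pow, pow_one]
    linear_combination q * this
  have hg2 : (1 - q) * (1 - q ^ 2) * g 2 = q ^ 4 := by
    have h0 := hu 0
    have h1 := hu 1
    rw [qFactRecip_zero, zero_add, pow_one] at h0
    simp only [hg]
    norm_num at h1 ⊢
    linear_combination q ^ 4 * h0 + q ^ 4 * (1 - q) * h1
  have hg2' : (1 - q) * (1 - q ^ M) * g 2 = q ^ 4 * qBracket (M / 2) (q ^ 2) := by
    rw [← hbr]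
    linear_combination qBracket (M / 2) (q ^ 2) * hg2
  have hqM : q ^ M = q ^ 4 * q ^ (M - 4) := by rw [← pow_add, Nat.add_sub_cancel' hM]
  rw [Finset.sum_congr rfl hmid, ← Finset.mul_sum, htail, hshift.tsum_mul_left, fpsRecip_mul,
    hprod, hsplit, ← ha, hg0]
  -- The opening terms match because `1 + tqa = a` and `a + ab(w-1)q^M = ab(1-q^M)`.
  linear_combination (-a * b * (1 - q ^ M)) * hg1 - (a * b) * hg2' + (-1) * ha1 - a * hb1
    - a * b * (W - 1) * hqM
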